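/- Let $K\subset\mathbb R^n$ be a convex body (compact, convex, with nonempty interior). The set of normals $H$ of a convex body is the set of its outer unit normals at regular boundary points, i.e. at the boundary points with exactly one outer unit normal (for a polytope: the outer unit normals of its facets). For a set $X$ contained in a translate of $K$, let $\operatorname{conv}_K X$ be the intersection of all translates of $K$ that contain $X$. The Carathéodory number for $K$-strong convexity is the smallest integer $k\ge 0$ such that $$\operatorname{conv}_K X=\bigcup_{X'\subseteq X,\ |X'|\le k}\operatorname{conv}_K X'$$ for every closed set $X$ contained in a translate of $K$ (and $\infty$ if there is no such $k$). A pyramid in $\mathbb R^n$ with base $B$ is the convex hull of $B\cup\{p\}$, where $B\subset\mathbb R^n$ is an $(n-1)$-dimensional polytope and $p$ is a point outside the hyperplane spanned by $B$. **Corollary.** Suppose that $K$ has the same set of normals $H$ as some pyramid with base $B$ that is not a simplex. Then the Carathéodory number for $K$-strong convexity equals the number of relative facets of $B$, i.e. of $(n-2)$-dimensional faces of $B$, and this number is $|H|-1$. -/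

import Mathlib

open scoped Pointwise

noncomputable section

/-- A set is `K`-strongly convex if it is an intersection of translates of `K`. -/
def IsStronglyConvex {n : ℕ} (K S : Set (EuclideanSpace ℝ (Fin n))) : Prop :=
  ∃ T : Set (EuclideanSpace ℝ (Fin n)), T.Nonempty ∧ S = ⋂ t ∈ T, (t +ᵥ K)

/-- The `K`-strongly convex hull of `X`: the intersection of all translates of `K` that
contain `X`. It is only meaningful when `X` is contained in some translate of `K`, and then it
is the least `K`-strongly convex set containing `X`, see `isLeast_strongHull`. -/
def strongHull {n : ℕ} (K X : Set (EuclideanSpace ℝ (Fin n))) :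
    Set (EuclideanSpace ℝ (Fin n)) :=
  ⋂ t ∈ {t : EuclideanSpace ℝ (Fin n) | X ⊆ t +ᵥ K}, (t +ᵥ K)

theorem isLeast_strongHull {n : ℕ} (K X : Set (EuclideanSpace ℝ (Fin n)))
    (hX : ∃ t : EuclideanSpace ℝ (Fin n), X ⊆ t +ᵥ K) :
    IsLeast {S | IsStronglyConvex K S ∧ X ⊆ S} (strongHull K X) := by
  refine ⟨⟨⟨_, hX, rfl⟩, Set.subset_iInter₂ fun t ht => ht⟩, ?_⟩
  rintro S ⟨⟨T, -, rfl⟩, hS⟩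
  refine Set.subset_iInter₂ fun t ht => ?_
  exact Set.biInter_subset_of_mem (show X ⊆ t +ᵥ K from hS.trans (Set.biInter_subset_of_mem ht))

/-- For every closed set `X` contained in a translate of `K`, the `K`-strongly convex hull of `X`
is the union of the `K`-strongly convex hulls of the subsets of `X` with at most `k` points. -/
def HasCaratheodoryProperty {n : ℕ} (K : Set (EuclideanSpace ℝ (Fin n))) (k : ℕ) : Prop :=
  ∀ X : Set (EuclideanSpace ℝ (Fin n)), IsClosed X →
    (∃ t : EuclideanSpace ℝ (Fin n), X ⊆ t +ᵥ K) →
    strongHull K X = ⋃ X' ∈ {X' : Set (EuclideanSpace ℝ (Fin n)) | X' ⊆ X ∧ X'.encard ≤ k},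
      strongHull K X'

/-- The Carathéodory number for `K`-strong convexity: the smallest `k` with the Carathéodory
property, and `⊤` if there is none. -/
def caratheodoryNumber {n : ℕ} (K : Set (EuclideanSpace ℝ (Fin n))) : ℕ∞ :=
  ⨅ (k : ℕ) (_ : HasCaratheodoryProperty K k), (k : ℕ∞)

/-- `u` is an outer unit normal of `K` at its point `x`. -/
def IsOuterNormalAt {n : ℕ} (K : Set (EuclideanSpace ℝ (Fin n)))
    (x u : EuclideanSpace ℝ (Fin n)) : Prop :=
  ‖u‖ = 1 ∧ x ∈ K ∧ ∀ y ∈ K, inner ℝ u y ≤ inner ℝ u x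

/-- The set of normals of a convex body `K`: the outer unit normals at the regular boundary
points, that is, at the points of `K` with exactly one outer unit normal. For a full-dimensional
polytope these are the outer unit normals of the facets. -/
def normals {n : ℕ} (K : Set (EuclideanSpace ℝ (Fin n))) : Set (EuclideanSpace ℝ (Fin n)) :=
  {u | ∃ x, IsOuterNormalAt K x u ∧ ∀ v, IsOuterNormalAt K x v → v = u}

/-- A polytope: the convex hull of finitely many points. -/
def IsPolytope {n : ℕ} (P : Set (EuclideanSpace ℝ (Fin n))) : Prop :=
  ∃ s : Set (EuclideanSpace ℝ (Fin n)), s.Finite ∧ P = convexHull ℝ s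

/-- A simplex: the convex hull of a nonempty finite family of affinely independent points. -/
def IsSimplex {n : ℕ} (P : Set (EuclideanSpace ℝ (Fin n))) : Prop :=
  ∃ (m : ℕ) (s : Affine.Simplex ℝ (EuclideanSpace ℝ (Fin n)) m),
    P = convexHull ℝ (Set.range s.points)

/-- The relative facets of a polytope `B`: its nonempty faces of dimension `dim B - 1`. -/
def relativeFacets {n : ℕ} (B : Set (EuclideanSpace ℝ (Fin n))) :
    Set (Set (EuclideanSpace ℝ (Fin n))) :=
  {F | F.Nonempty ∧ IsExposed ℝ B F ∧
    Module.finrank ℝ (vectorSpan ℝ F) + 1 = Module.finrank ℝ (vectorSpan ℝ B)}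

/-- `P` is a pyramid in `ℝⁿ` with base `B`: the base is a nonempty polytope of dimension
`n - 1`, and `P` is the convex hull of `B` and a point outside the hyperplane spanned by `B`. -/
def IsPyramidWithBase {n : ℕ} (P B : Set (EuclideanSpace ℝ (Fin n))) : Prop :=
  IsPolytope B ∧ B.Nonempty ∧ Module.finrank ℝ (vectorSpan ℝ B) + 1 = n ∧
    ∃ p, p ∉ affineSpan ℝ B ∧ P = convexHull ℝ (insert p B)

end

/-! Each convex body `K` is the intersection of its supporting half-spaces at regular points, so a
translate of `K` is given by the inequalities `⟪u, x⟫ ≤ h u + ⟪u, t⟫` for `u ∈ H`. Here `H` is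
finite, being the set of facet normals of a pyramid, and each inequality is irredundant: some point
of its facet is strict for all the others.

Upper bound. As the pyramid is not a simplex, `H` has at least `n + 2` elements. Boundedness of `K`
puts `0` in the convex hull of `H`, and Carathéodory's theorem allows some `w` to be omitted. Given
`x` in the hull of `X`, let `a u` be a point of `X` farthest in direction `u`; one of these points
can be dropped. If `x` lies beyond `a d` in direction `d`, a sliding argument removes `d`.
Otherwise, if `a i` reaches as far as `x` in a direction `j ≠ i`, then `a j` is superfluous. If
neither happens, all `u ≠ w` are negative on `a w - x`, contradicting `0 ∈ convexHull ℝ (H \ {w})`.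
See `hasCaratheodoryProperty_of_zero_mem_convexHull`.

Lower bound. The vectors from the apex to regular points of the lateral facets, scaled down, have
`0` in their hull, and dropping any one loses it: a translate of `K` excludes `0` by the
corresponding inequality alone. See `ncard_le_of_hasCaratheodoryProperty`.

Finally, intersecting with `B` matches lateral facets with relative facets of the base. -/

/-! ### Supporting half-spaces at regular boundary points -/

/-- A linear functional whose maximum over a convex body is attained at a boundary point `y`
yields an outer unit normal at `y`. -/
theorem exists_isOuterNormalAt {n : ℕ} {K : Set (EuclideanSpace ℝ (Fin n))}
    (hconv : Convex ℝ K) (hint : (interior K).Nonempty) {y : EuclideanSpace ℝ (Fin n)}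
    (hy : y ∈ K) (hy' : y ∉ interior K) : ∃ v, IsOuterNormalAt K y v := by
  obtain ⟨f, hf0, hf⟩ := geometric_hahn_banach_of_nonempty_interior_point hconv hy' hint
  set w := (InnerProductSpace.toDual ℝ (EuclideanSpace ℝ (Fin n))).symm f with hw
  have hfw : ∀ z, f z = inner ℝ w z := fun z => by
    rw [hw, InnerProductSpace.toDual_symm_apply]
  have hw0 : w ≠ 0 := by
    rw [hw]; simpa using hf0
  have hpos : 0 < ‖w‖ := norm_pos_iff.2 hw0
  refine ⟨(‖w‖)⁻¹ • w, ?_, hy, fun z hz => ?_⟩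
  · rw [norm_smul, norm_inv, norm_norm, inv_mul_cancel₀ hpos.ne']
  · rw [real_inner_smul_left, real_inner_smul_left, ← hfw, ← hfw]
    exact mul_le_mul_of_nonneg_left (hf z hz) (inv_nonneg.2 hpos.le)

/-- If a closed ball with radius `d` contained in `K` is centered at `z`, then every outer unit
normal of `K` at `y` satisfies `d ≤ ⟪v, y - z⟫`. -/
theorem IsOuterNormalAt.le_inner_sub {n : ℕ} {K : Set (EuclideanSpace ℝ (Fin n))}
    {y v z : EuclideanSpace ℝ (Fin n)} {d : ℝ} (hv : IsOuterNormalAt K y v) (hd : 0 ≤ d)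
    (hball : Metric.closedBall z d ⊆ K) : d ≤ inner ℝ v (y - z) := by
  have h := hv.2.2 (z + d • v) (hball (by
    rw [Metric.mem_closedBall, dist_eq_norm, add_sub_cancel_left, norm_smul, hv.1,
      Real.norm_of_nonneg hd, mul_one]))
  rw [inner_add_right, real_inner_smul_right, real_inner_self_eq_norm_sq, hv.1] at h
  rw [inner_sub_right]
  linarith

/-- Every boundary point at which a ball contained in `K` touches the boundary is regular. -/
theorem IsOuterNormalAt.eq_of_closedBall_subset {n : ℕ} {K : Set (EuclideanSpace ℝ (Fin n))}
    {y v z : EuclideanSpace ℝ (Fin n)} {d : ℝ} (hv : IsOuterNormalAt K y v) (hd : 0 < d)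
    (hball : Metric.closedBall z d ⊆ K) (hyz : dist z y = d) : y - z = d • v := by
  have h1 := hv.le_inner_sub hd.le hball
  have h2 : ‖y - z‖ = d := by rw [← dist_eq_norm, dist_comm, hyz]
  have h3 : inner ℝ v (y - z) = ‖v‖ * ‖y - z‖ := by
    refine le_antisymm (real_inner_le_norm _ _) ?_
    rw [hv.1, h2, one_mul]; exact h1
  rw [inner_eq_norm_mul_iff_real, hv.1, h2, one_smul] at h3
  exact h3.symm

theorem closedBall_infDist_compl_subset {n : ℕ} {K : Set (EuclideanSpace ℝ (Fin n))}
    (hcl : IsClosed K) {z : EuclideanSpace ℝ (Fin n)} (hz : 0 < Metric.infDist z Kᶜ) :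
    Metric.closedBall z (Metric.infDist z Kᶜ) ⊆ K := by
  rw [← closure_ball z hz.ne']
  refine closure_minimal (fun y hy => ?_) hcl
  by_contra hyK
  have := Metric.infDist_le_dist_of_mem (s := Kᶜ) (x := z) hyK
  rw [Metric.mem_ball, dist_comm] at hy
  linarith

/-- A convex body is the intersection of its supporting half-spaces at regular boundary
points. -/
theorem mem_of_forall_normals {n : ℕ} {K : Set (EuclideanSpace ℝ (Fin n))}
    (hcl : IsClosed K) (hconv : Convex ℝ K) (hint : (interior K).Nonempty)
    {x : EuclideanSpace ℝ (Fin n)}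
    (hx : ∀ u ∈ normals K, ∀ y, IsOuterNormalAt K y u → inner ℝ u x ≤ inner ℝ u y) : x ∈ K := by
  by_contra hxK
  obtain ⟨z₀, hz₀⟩ := hint
  obtain ⟨R, hR, hRK⟩ := Metric.nhds_basis_closedBall.mem_iff.1 (mem_interior_iff_mem_nhds.1 hz₀)
  have hne : (Kᶜ).Nonempty := ⟨x, hxK⟩
  let z : ℝ → EuclideanSpace ℝ (Fin n) := fun s => AffineMap.lineMap z₀ x s
  have hzc : Continuous z := AffineMap.lineMap_continuous
  -- Stopping before `x` keeps `1 - s` positive below; at `s = 1` the function `g` vanishes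
  -- trivially.
  obtain ⟨s₁, hs₁, hs₁0, hzs₁⟩ : ∃ s < (1 : ℝ), 0 ≤ s ∧ z s ∈ Kᶜ := by
    have hopen : IsOpen (z ⁻¹' Kᶜ) := hcl.isOpen_compl.preimage hzc
    have h1 : (1 : ℝ) ∈ z ⁻¹' Kᶜ := by simpa [z] using hxK
    obtain ⟨e, he, heb⟩ := Metric.isOpen_iff.1 hopen 1 h1
    refine ⟨max (1 - e / 2) 0, max_lt (by linarith) one_pos, le_max_right _ _, heb ?_⟩
    rw [Metric.mem_ball, Real.dist_eq, abs_lt]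
    constructor
    · have := le_max_left (1 - e / 2) 0
      linarith
    · have : max (1 - e / 2) 0 < 1 := max_lt (by linarith) one_pos
      linarith
  -- If the supporting half-space at the touching point contained `x`, interpolation between `z₀`
  -- (slack at least `R`) and `x` would give slack at least `(1 - s) * R` at `z s`. A zero of `g`
  -- makes that slack only half as large.
  let g : ℝ → ℝ := fun s => Metric.infDist (z s) Kᶜ - (1 - s) * (R / 2)
  have hg : Continuous g :=
    ((Metric.continuous_infDist_pt _).comp hzc).sub (by fun_prop)
  have hg0 : 0 ≤ g 0 := by
    have : R ≤ Metric.infDist (z 0) Kᶜ := by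
      refine (Metric.le_infDist hne).2 fun {y} hy => ?_
      by_contra hlt
      refine hy (hRK ?_)
      rw [Metric.mem_closedBall, dist_comm]
      simpa [z] using (not_le.1 hlt).le
    simp only [g]
    linarith
  have hg1 : g s₁ ≤ 0 := by
    simp only [g]
    rw [Metric.infDist_zero_of_mem hzs₁]
    nlinarith
  obtain ⟨s, ⟨hs0, hss⟩, hs⟩ := intermediate_value_Icc' hs₁0 hg.continuousOn ⟨hg1, hg0⟩
  have hs1 : 0 < 1 - s := by linarith
  set d := Metric.infDist (z s) Kᶜ with hd
  have hds : d = (1 - s) * (R / 2) := sub_eq_zero.1 hs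
  have hdpos : 0 < d := by rw [hds]; positivity
  have hball := closedBall_infDist_compl_subset hcl hdpos
  obtain ⟨y, hy, hdy⟩ := Metric.exists_mem_closure_infDist_eq_dist hne (z s)
  have hyK : y ∈ K := hball (by rw [Metric.mem_closedBall, dist_comm, hdy])
  have hyi : y ∉ interior K := by rwa [closure_compl] at hy
  obtain ⟨v, hv⟩ := exists_isOuterNormalAt hconv ⟨z₀, hz₀⟩ hyK hyi
  have hvn : v ∈ normals K := by
    refine ⟨y, hv, fun w hw => ?_⟩
    have h1 := hv.eq_of_closedBall_subset hdpos hball hdy.symm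
    have h2 := hw.eq_of_closedBall_subset hdpos hball hdy.symm
    exact smul_right_injective _ hdpos.ne' (h2.symm.trans h1)
  have h1 := hv.eq_of_closedBall_subset hdpos hball hdy.symm
  have h2 := hx v hvn y hv
  have h3 := hv.le_inner_sub hR.le hRK
  have h4 : inner ℝ v (y - z s) = d := by
    rw [h1, real_inner_smul_right, real_inner_self_eq_norm_sq, hv.1]; ring
  have h5 : y - z s = (1 - s) • (y - z₀) + s • (y - x) := by
    simp only [z, AffineMap.lineMap_apply_module]
    module
  rw [h5, inner_add_right, real_inner_smul_right, real_inner_smul_right, hds] at h4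
  rw [inner_sub_right v y x] at h4
  nlinarith [mul_le_mul_of_nonneg_left h3 hs1.le, mul_nonneg hs0 (sub_nonneg.2 h2)]

/-- A convex body is cut out by half-spaces with outer normals in `normals K`, each of which has
a boundary point lying in the interior of all the others. -/
theorem exists_facet_representation {n : ℕ} {K : Set (EuclideanSpace ℝ (Fin n))}
    (hcl : IsClosed K) (hconv : Convex ℝ K) (hint : (interior K).Nonempty) :
    ∃ (h : EuclideanSpace ℝ (Fin n) → ℝ) (q : EuclideanSpace ℝ (Fin n) → EuclideanSpace ℝ (Fin n)),
      (∀ x, x ∈ K ↔ ∀ u ∈ normals K, inner ℝ u x ≤ h u) ∧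
      ∀ u ∈ normals K, q u ∈ K ∧ inner ℝ u (q u) = h u ∧
        ∀ v ∈ normals K, v ≠ u → inner ℝ v (q u) < h v := by
  have hch : ∀ u, ∃ y, u ∈ normals K → IsOuterNormalAt K y u ∧
      ∀ v, IsOuterNormalAt K y v → v = u := fun u => by
    by_cases hu : u ∈ normals K
    · exact ⟨hu.choose, fun _ => hu.choose_spec⟩
    · exact ⟨0, fun h => absurd h hu⟩
  choose q hq using hch
  refine ⟨fun u => inner ℝ u (q u), q, fun x => ⟨fun hx u hu => (hq u hu).1.2.2 x hx, fun hx => ?_⟩,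
    fun u hu => ⟨(hq u hu).1.2.1, rfl, fun v hv hvu => ?_⟩⟩
  · refine mem_of_forall_normals hcl hconv hint fun u hu y hy => (hx u hu).trans ?_
    exact hy.2.2 _ (hq u hu).1.2.1
  · refine lt_of_le_of_ne ((hq v hv).1.2.2 _ (hq u hu).1.2.1) fun heq => hvu ?_
    refine (hq u hu).2 v ⟨(hq v hv).1.1, (hq u hu).1.2.1, fun y hy => ?_⟩
    rw [heq]
    exact (hq v hv).1.2.2 y hy

/-! ### Strong hulls through facet normals, and the upper bound -/

theorem mem_vadd_set_iff_sub_mem {n : ℕ} {K : Set (EuclideanSpace ℝ (Fin n))}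
    {t x : EuclideanSpace ℝ (Fin n)} : x ∈ t +ᵥ K ↔ x - t ∈ K := by
  rw [Set.mem_vadd_set_iff_neg_vadd_mem, vadd_eq_add, neg_add_eq_sub]

theorem mem_strongHull {n : ℕ} {K X : Set (EuclideanSpace ℝ (Fin n))}
    {x : EuclideanSpace ℝ (Fin n)} :
    x ∈ strongHull K X ↔ ∀ t : EuclideanSpace ℝ (Fin n), X ⊆ t +ᵥ K → x ∈ t +ᵥ K := by
  simp [strongHull]

theorem strongHull_mono {n : ℕ} (K : Set (EuclideanSpace ℝ (Fin n)))
    {X Y : Set (EuclideanSpace ℝ (Fin n))} (h : X ⊆ Y) : strongHull K X ⊆ strongHull K Y :=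
  fun _ hx => mem_strongHull.2 fun t ht => mem_strongHull.1 hx t (h.trans ht)

/-- A point belongs to the strong hull of a set that has, in the direction of every facet normal,
a point at least as far. -/
theorem mem_strongHull_of_forall_exists_le {n : ℕ} {K X H : Set (EuclideanSpace ℝ (Fin n))}
    {h : EuclideanSpace ℝ (Fin n) → ℝ} (hK : ∀ x, x ∈ K ↔ ∀ u ∈ H, inner ℝ u x ≤ h u)
    {x : EuclideanSpace ℝ (Fin n)} (hx : ∀ u ∈ H, ∃ y ∈ X, inner ℝ u x ≤ inner ℝ u y) :
    x ∈ strongHull K X := by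
  refine mem_strongHull.2 fun t ht => ?_
  rw [mem_vadd_set_iff_sub_mem, hK]
  intro u hu
  obtain ⟨y, hy, hxy⟩ := hx u hu
  have := (hK _).1 (mem_vadd_set_iff_sub_mem.1 (ht hy)) u hu
  rw [inner_sub_right] at this ⊢
  linarith

/-- If some facet normal `d` attains its maximum over `X` below `x`, then the farthest points in the
directions of the other facet normals suffice to have `x` in their strong hull. -/
theorem mem_strongHull_image_of_inner_lt {n : ℕ} {K X H : Set (EuclideanSpace ℝ (Fin n))}
    {h : EuclideanSpace ℝ (Fin n) → ℝ} (hK : ∀ x, x ∈ K ↔ ∀ u ∈ H, inner ℝ u x ≤ h u)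
    {a : EuclideanSpace ℝ (Fin n) → EuclideanSpace ℝ (Fin n)}
    (ha : ∀ u, a u ∈ X ∧ ∀ y ∈ X, inner ℝ u y ≤ inner ℝ u (a u))
    (ht : ∃ t : EuclideanSpace ℝ (Fin n), X ⊆ t +ᵥ K) {x : EuclideanSpace ℝ (Fin n)}
    (hx : x ∈ strongHull K X) {d : EuclideanSpace ℝ (Fin n)} (hd : d ∈ H)
    (hdx : inner ℝ d (a d) < inner ℝ d x) : x ∈ strongHull K (a '' (H \ {d})) := by
  have hsub : ∀ t : EuclideanSpace ℝ (Fin n),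
      (∀ u ∈ H, inner ℝ u (a u) ≤ h u + inner ℝ u t) → X ⊆ t +ᵥ K := fun t hut y hy => by
    rw [mem_vadd_set_iff_sub_mem, hK]
    intro u hu
    rw [inner_sub_right]
    linarith [hut u hu, (ha u).2 y hy]
  have hmem : ∀ t x : EuclideanSpace ℝ (Fin n), x ∈ t +ᵥ K → ∀ u ∈ H,
      inner ℝ u x ≤ h u + inner ℝ u t := fun t x hxt u hu => by
    have := (hK _).1 (mem_vadd_set_iff_sub_mem.1 hxt) u hu
    rw [inner_sub_right] at this
    linarith
  obtain ⟨t₀, ht₀⟩ := ht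
  refine mem_strongHull.2 fun t ht => mem_strongHull.1 hx t (hsub t ?_)
  have hto : ∀ u ∈ H, u ≠ d → inner ℝ u (a u) ≤ h u + inner ℝ u t := fun u hu hud =>
    hmem t _ (ht ⟨u, ⟨hu, hud⟩, rfl⟩) u hu
  intro u hu
  by_cases hud : u = d
  swap
  · exact hto u hu hud
  subst hud
  -- Slide `t` towards `t₀` until the `d`-inequality becomes tight at `a d`. The other inequalities
  -- survive by convexity, so this translate contains `X`, hence `x`, which contradicts `hdx`.
  by_contra! hlt
  have h0 := hmem t₀ _ (ht₀ (ha u).1) u hu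
  set A := inner ℝ u (a u) - h u with hA
  have h1 : inner ℝ u t < A := by linarith
  have h2 : A ≤ inner ℝ u t₀ := by linarith
  set s := (A - inner ℝ u t) / (inner ℝ u t₀ - inner ℝ u t) with hs
  have hpos : 0 < inner ℝ u t₀ - inner ℝ u t := by linarith
  have hs0 : 0 ≤ s := div_nonneg (by linarith) hpos.le
  have hs1 : s ≤ 1 := (div_le_one hpos).2 (by linarith)
  have hsA : (1 - s) * inner ℝ u t + s * inner ℝ u t₀ = A := by
    have : s * (inner ℝ u t₀ - inner ℝ u t) = A - inner ℝ u t := div_mul_cancel₀ _ hpos.ne'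
    linarith
  have hX : X ⊆ ((1 - s) • t + s • t₀) +ᵥ K := by
    refine hsub _ fun v hv => ?_
    rw [inner_add_right, real_inner_smul_right, real_inner_smul_right]
    by_cases hvu : v = u
    · subst hvu
      rw [hsA]; linarith
    · have e1 := hto v hv hvu
      have e2 := hmem t₀ _ (ht₀ (ha v).1) v hv
      nlinarith [mul_le_mul_of_nonneg_left e1 (sub_nonneg.2 hs1), mul_le_mul_of_nonneg_left e2 hs0]
  have := hmem _ _ (mem_strongHull.1 hx _ hX) u hu
  rw [inner_add_right, real_inner_smul_right, real_inner_smul_right, hsA] at this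
  linarith

/-- If the origin lies in the convex hull of a proper subset of the facet normals, then the
Carathéodory number is less than the number of facets. -/
theorem hasCaratheodoryProperty_of_zero_mem_convexHull {n : ℕ}
    {K H : Set (EuclideanSpace ℝ (Fin n))} (hcomp : IsCompact K) (hH : H.Finite)
    {h : EuclideanSpace ℝ (Fin n) → ℝ} (hK : ∀ x, x ∈ K ↔ ∀ u ∈ H, inner ℝ u x ≤ h u)
    {w : EuclideanSpace ℝ (Fin n)} (hw : w ∈ H) (h0 : 0 ∈ convexHull ℝ (H \ {w})) :
    HasCaratheodoryProperty K (H.ncard - 1) := by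
  intro X hX htX
  refine Set.Subset.antisymm (fun x hx => ?_) (Set.iUnion₂_subset fun X' hX' =>
    strongHull_mono K hX'.1)
  rw [Set.mem_iUnion₂]
  rcases X.eq_empty_or_nonempty with rfl | hXne
  · exact ⟨∅, ⟨le_rfl, by simp⟩, hx⟩
  have hXc : IsCompact X := by
    obtain ⟨t, ht⟩ := htX
    exact (hcomp.vadd t).of_isClosed_subset hX ht
  have hex : ∀ u : EuclideanSpace ℝ (Fin n), ∃ y ∈ X, ∀ z ∈ X, inner ℝ u z ≤ inner ℝ u y := fun u =>
    hXc.exists_isMaxOn (f := fun y => inner ℝ u y) hXne (by fun_prop)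
  choose a haX ha using hex
  suffices hj : ∃ j ∈ H, x ∈ strongHull K (a '' (H \ {j})) by
    obtain ⟨j, hj, hxj⟩ := hj
    refine ⟨_, ⟨?_, ?_⟩, hxj⟩
    · rintro _ ⟨u, -, rfl⟩
      exact haX u
    · refine (Set.encard_image_le _ _).trans ?_
      rw [← Set.ncard_sdiff_singleton_of_mem hj, (hH.subset Set.sdiff_subset).cast_ncard_eq]
  by_cases hD : ∃ d ∈ H, inner ℝ d (a d) < inner ℝ d x
  · obtain ⟨d, hd, hdx⟩ := hD
    exact ⟨d, hd, mem_strongHull_image_of_inner_lt hK (fun u => ⟨haX u, ha u⟩) htX hx hd hdx⟩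
  push Not at hD
  by_cases hI : ∃ j ∈ H, ∃ i ∈ H, i ≠ j ∧ inner ℝ j x ≤ inner ℝ j (a i)
  · obtain ⟨j, hj, i, hi, hij, hle⟩ := hI
    refine ⟨j, hj, mem_strongHull_of_forall_exists_le hK fun u hu => ?_⟩
    by_cases huj : u = j
    · subst huj
      exact ⟨a i, ⟨i, ⟨hi, hij⟩, rfl⟩, hle⟩
    · exact ⟨a u, ⟨u, ⟨hu, huj⟩, rfl⟩, hD u hu⟩
  push Not at hI
  -- Now no `a i` reaches `x` in a direction other than its own, so all of `H \ {w}` lies in an open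
  -- half-space bounded by a hyperplane through `0`.
  have hconv : Convex ℝ {u : EuclideanSpace ℝ (Fin n) | inner ℝ u (a w - x) < 0} :=
    convex_halfSpace_lt ⟨fun _ _ => inner_add_left _ _ _, fun _ _ => real_inner_smul_left _ _ _⟩ _
  have := convexHull_min (fun u hu => ?_) hconv h0
  · simp at this
  · have := hI u hu.1 w hw (Ne.symm hu.2)
    rw [Set.mem_ofPred_eq, inner_sub_right]
    linarith

/-- The origin lies in the convex hull of the facet normals of a bounded polyhedron. -/
theorem zero_mem_convexHull_of_isBounded {n : ℕ} {K H : Set (EuclideanSpace ℝ (Fin n))}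
    (hb : Bornology.IsBounded K) (hne : K.Nonempty) (hH : H.Finite) (hHne : H.Nonempty)
    {h : EuclideanSpace ℝ (Fin n) → ℝ} (hK : ∀ x, x ∈ K ↔ ∀ u ∈ H, inner ℝ u x ≤ h u) :
    0 ∈ convexHull ℝ H := by
  by_contra h0
  obtain ⟨f, c, hf, hc⟩ := geometric_hahn_banach_closed_point (convex_convexHull ℝ H)
    (hH.isClosed_convexHull (𝕜 := ℝ)) h0
  set d := (InnerProductSpace.toDual ℝ (EuclideanSpace ℝ (Fin n))).symm f with hd
  have hfd : ∀ u ∈ H, inner ℝ u d < 0 := fun u hu => by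
    have := hf u (subset_convexHull ℝ H hu)
    rw [map_zero] at hc
    rw [real_inner_comm, hd, InnerProductSpace.toDual_symm_apply]
    linarith
  have hd0 : d ≠ 0 := by
    obtain ⟨u, hu⟩ := hHne
    intro h
    have := hfd u hu
    rw [h, inner_zero_right] at this
    exact lt_irrefl _ this
  obtain ⟨x, hx⟩ := hne
  obtain ⟨C, hC⟩ := isBounded_iff_forall_norm_le.1 hb
  -- The separating direction is a recession direction of `K`, contrary to boundedness.
  have hray : ∀ t : ℝ, 0 ≤ t → x + t • d ∈ K := fun t ht => by
    rw [hK]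
    intro u hu
    rw [inner_add_right, real_inner_smul_right]
    nlinarith [(hK x).1 hx u hu, hfd u hu]
  have hdpos := norm_pos_iff.2 hd0
  have hC0 : 0 ≤ C := (norm_nonneg _).trans (hC x hx)
  have h1 := hC _ (hray ((C + ‖x‖ + 1) / ‖d‖) (by positivity))
  have h2 : ‖((C + ‖x‖ + 1) / ‖d‖) • d‖ = C + ‖x‖ + 1 := by
    rw [norm_smul, Real.norm_of_nonneg (by positivity), div_mul_cancel₀ _ hdpos.ne']
  have h3 := norm_sub_le (x + ((C + ‖x‖ + 1) / ‖d‖) • d) x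
  rw [add_sub_cancel_left, h2] at h3
  linarith

/-- Carathéodory's theorem: with more than `n + 1` points, one may be dropped. -/
theorem exists_mem_convexHull_diff_singleton {n : ℕ} {H : Set (EuclideanSpace ℝ (Fin n))}
    {x : EuclideanSpace ℝ (Fin n)} (hx : x ∈ convexHull ℝ H)
    (hcard : n + 2 ≤ H.ncard) : ∃ w ∈ H, x ∈ convexHull ℝ (H \ {w}) := by
  rw [convexHull_eq_union] at hx
  simp only [Set.mem_iUnion] at hx
  obtain ⟨t, htH, hti, hxt⟩ := hx
  have h1 : t.card ≤ n + 1 := by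
    have := hti.card_le_finrank_succ
    rw [Fintype.card_coe] at this
    refine this.trans (Nat.succ_le_succ ((Submodule.finrank_le _).trans ?_))
    rw [finrank_euclideanSpace_fin]
  obtain ⟨w, hw, hwt⟩ : ∃ w ∈ H, w ∉ (t : Set (EuclideanSpace ℝ (Fin n))) := by
    by_contra! hall
    have := Set.ncard_le_ncard hall t.finite_toSet
    rw [Set.ncard_coe_finset] at this
    omega
  have hsub : (t : Set (EuclideanSpace ℝ (Fin n))) ⊆ H \ {w} :=
    fun u hu => ⟨htH hu, fun h => hwt (h ▸ hu)⟩
  exact ⟨w, hw, convexHull_mono hsub hxt⟩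

/-! ### The lower bound -/

open Filter Topology in
/-- A lower bound for the Carathéodory number from a family of points `a u`, one in the
relative interior of each facet of the cone dual to the facet normals `u ∈ S`. -/
theorem ncard_le_of_hasCaratheodoryProperty {n : ℕ} {K H S : Set (EuclideanSpace ℝ (Fin n))}
    (hH : H.Finite) (hSH : S ⊆ H) (hne : (interior K).Nonempty) (hnorm : ∀ u ∈ H, ‖u‖ = 1)
    {h : EuclideanSpace ℝ (Fin n) → ℝ} {q : EuclideanSpace ℝ (Fin n) → EuclideanSpace ℝ (Fin n)}
    (hK : ∀ x, x ∈ K ↔ ∀ u ∈ H, inner ℝ u x ≤ h u)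
    (hq : ∀ u ∈ H, inner ℝ u (q u) = h u ∧ ∀ v ∈ H, v ≠ u → inner ℝ v (q u) < h v)
    {a : EuclideanSpace ℝ (Fin n) → EuclideanSpace ℝ (Fin n)}
    (haS : ∀ u ∈ S, inner ℝ u (a u) = 0 ∧ ∀ v ∈ S, v ≠ u → inner ℝ v (a u) < 0)
    (haH : ∀ v ∈ H \ S, ∃ u ∈ S, 0 ≤ inner ℝ v (a u)) {k : ℕ}
    (hk : HasCaratheodoryProperty K k) : S.ncard ≤ k := by
  by_contra! hkS
  have hS : S.Finite := hH.subset hSH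
  obtain ⟨c, hc0, hc⟩ : ∃ c : ℝ, 0 < c ∧ ∀ u ∈ S, ∀ v ∈ S, v ≠ u → inner ℝ v (a u) ≤ -c := by
    have hev : ∀ᶠ c : ℝ in 𝓝[>] 0, ∀ u ∈ S, ∀ v ∈ S, v ≠ u → inner ℝ v (a u) ≤ -c := by
      refine hS.eventually_all.2 fun u hu => hS.eventually_all.2 fun v hv => ?_
      by_cases hvu : v = u
      · simp [hvu]
      have : 0 < -inner ℝ v (a u) := neg_pos.2 ((haS u hu).2 v hv hvu)
      filter_upwards [Ioo_mem_nhdsGT this] with c hcv _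
      linarith [hcv.2]
    obtain ⟨c, hc, hc0⟩ := (hev.and self_mem_nhdsWithin).exists
    exact ⟨c, hc0, hc⟩
  obtain ⟨z, hz⟩ := hne
  -- Small `e` serves twice: the scaled points fit into a translate of `K`, and a perturbation of `q
  -- u` of order `e` keeps all inequalities other than that of `u`, which are strict at `q u`.
  obtain ⟨e, he0, he1, he2⟩ : ∃ e : ℝ, 0 < e ∧ (∀ u ∈ S, z + e • a u ∈ K) ∧
      ∀ u ∈ S, ∀ v ∈ S, ∀ w ∈ H, w ≠ u →
        e * inner ℝ w (a v) + e * c * inner ℝ w u + inner ℝ w (q u) ≤ h w := by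
    have hev1 : ∀ᶠ e : ℝ in 𝓝[>] 0, ∀ u ∈ S, z + e • a u ∈ K := by
      refine hS.eventually_all.2 fun u hu => ?_
      have hcont : Continuous fun e : ℝ => z + e • a u := by fun_prop
      have hlim : Tendsto (fun e : ℝ => z + e • a u) (𝓝[>] 0) (𝓝 z) := by
        have := hcont.tendsto 0
        rw [zero_smul, add_zero] at this
        exact this.mono_left nhdsWithin_le_nhds
      exact hlim.eventually (mem_interior_iff_mem_nhds.1 hz)
    have hev2 : ∀ᶠ e : ℝ in 𝓝[>] 0, ∀ u ∈ S, ∀ v ∈ S, ∀ w ∈ H, w ≠ u →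
        e * inner ℝ w (a v) + e * c * inner ℝ w u + inner ℝ w (q u) ≤ h w := by
      refine hS.eventually_all.2 fun u hu => hS.eventually_all.2 fun v hv =>
        hH.eventually_all.2 fun w hw => ?_
      by_cases hwu : w = u
      · simp [hwu]
      have hcont : Continuous fun e : ℝ =>
        e * inner ℝ w (a v) + e * c * inner ℝ w u + inner ℝ w (q u) := by fun_prop
      have hlim := (hcont.tendsto 0).mono_left (nhdsWithin_le_nhds (s := Set.Ioi 0))
      rw [zero_mul, zero_mul, zero_mul, zero_add, zero_add] at hlim
      filter_upwards [hlim.eventually (gt_mem_nhds ((hq u (hSH hu)).2 w hw hwu))] with e he _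
      exact he.le
    obtain ⟨e, ⟨he1, he2⟩, he0⟩ := ((hev1.and hev2).and self_mem_nhdsWithin).exists
    exact ⟨e, he0, he1, he2⟩
  have hinj : Set.InjOn a S := fun u hu v hv huv => by
    by_contra hne
    have h1 := (haS v hv).2 u hu hne
    rw [← huv, (haS u hu).1] at h1
    exact lt_irrefl _ h1
  have hinj' : Set.InjOn (fun u => e • a u) S := fun u hu v hv huv =>
    hinj hu hv (smul_right_injective _ he0.ne' huv)
  have hX := hk ((fun u => e • a u) '' S) (hS.image _).isClosed ⟨-z, by
    rintro _ ⟨u, hu, rfl⟩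
    rw [mem_vadd_set_iff_sub_mem, sub_neg_eq_add, add_comm]
    exact he1 u hu⟩
  have h0 : (0 : EuclideanSpace ℝ (Fin n)) ∈ strongHull K ((fun u => e • a u) '' S) := by
    refine mem_strongHull_of_forall_exists_le hK fun v hv => ?_
    by_cases hvS : v ∈ S
    · refine ⟨_, ⟨v, hvS, rfl⟩, ?_⟩
      rw [inner_zero_right, real_inner_smul_right, (haS v hvS).1, mul_zero]
    · obtain ⟨u, hu, hle⟩ := haH v ⟨hv, hvS⟩
      refine ⟨_, ⟨u, hu, rfl⟩, ?_⟩
      rw [inner_zero_right, real_inner_smul_right]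
      positivity
  rw [hX, Set.mem_iUnion₂] at h0
  obtain ⟨X', ⟨hX', hcard⟩, h0⟩ := h0
  obtain ⟨u, hu, huX⟩ : ∃ u ∈ S, e • a u ∉ X' := by
    by_contra! hall
    have hsub : (fun u => e • a u) '' S ⊆ X' := by
      rintro _ ⟨u, hu, rfl⟩
      exact hall u hu
    have h1 := (Set.encard_le_encard hsub).trans hcard
    rw [hinj'.encard_image, ← hS.cast_ncard_eq] at h1
    exact absurd (Nat.cast_le.1 h1) (not_le.2 hkS)
  -- This translate puts `0` beyond the `u`-facet by exactly `e * c`, while every remaining point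
  -- lies at least `e * c` behind `0` in direction `u`.
  have hmem := mem_strongHull.1 h0 (-(q u + (e * c) • u)) fun y hy => by
    obtain ⟨v, hv, rfl⟩ := hX' hy
    have hvu : u ≠ v := fun h => huX (h ▸ hy)
    rw [mem_vadd_set_iff_sub_mem, hK]
    intro w hw
    rw [sub_neg_eq_add, inner_add_right, inner_add_right, real_inner_smul_right,
      real_inner_smul_right]
    by_cases hwu : w = u
    · subst hwu
      rw [real_inner_self_eq_norm_sq, hnorm w hw, (hq w hw).1]
      nlinarith [hc v hv w hu hvu]
    · linarith [he2 u hu v hv w hw hwu]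
  rw [mem_vadd_set_iff_sub_mem, hK] at hmem
  have := hmem u (hSH hu)
  rw [sub_neg_eq_add, zero_add, inner_add_right, real_inner_smul_right,
    real_inner_self_eq_norm_sq, hnorm u (hSH hu), (hq u (hSH hu)).1] at this
  nlinarith [mul_pos he0 hc0]

/-! ### Support faces and facet normals of polytopes -/

/-- The face of `P` on which `inner ℝ u` attains its maximum. -/
def supportFace {n : ℕ} (P : Set (EuclideanSpace ℝ (Fin n))) (u : EuclideanSpace ℝ (Fin n)) :
    Set (EuclideanSpace ℝ (Fin n)) :=
  {x ∈ P | ∀ y ∈ P, inner ℝ u y ≤ inner ℝ u x}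

theorem isExposed_supportFace {n : ℕ} (P : Set (EuclideanSpace ℝ (Fin n)))
    (u : EuclideanSpace ℝ (Fin n)) : IsExposed ℝ P (supportFace P u) :=
  fun _ => ⟨innerSL ℝ u, rfl⟩

theorem inner_eq_of_mem_supportFace {n : ℕ} {P : Set (EuclideanSpace ℝ (Fin n))}
    {u x y : EuclideanSpace ℝ (Fin n)} (hx : x ∈ supportFace P u) (hy : y ∈ supportFace P u) :
    inner ℝ u x = (inner ℝ u y : ℝ) :=
  le_antisymm (hy.2 x hx.1) (hx.2 y hy.1)

theorem mem_supportFace_of_inner_eq {n : ℕ} {P : Set (EuclideanSpace ℝ (Fin n))}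
    {u x y : EuclideanSpace ℝ (Fin n)} (hx : x ∈ P) (hy : y ∈ supportFace P u)
    (h : inner ℝ u x = (inner ℝ u y : ℝ)) : x ∈ supportFace P u :=
  ⟨hx, fun z hz => h ▸ hy.2 z hz⟩

theorem inner_le_of_mem_convexHull {n : ℕ} {s : Set (EuclideanSpace ℝ (Fin n))}
    {u : EuclideanSpace ℝ (Fin n)} {c : ℝ} (hs : ∀ x ∈ s, inner ℝ u x ≤ c)
    {x : EuclideanSpace ℝ (Fin n)} (hx : x ∈ convexHull ℝ s) : inner ℝ u x ≤ c :=
  convexHull_min (t := {x | inner ℝ u x ≤ c}) hs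
    (convex_halfSpace_le ⟨fun _ _ => inner_add_right _ _ _,
      fun _ _ => real_inner_smul_right _ _ _⟩ c) hx

theorem mem_orthogonal_vectorSpan {n : ℕ} {F : Set (EuclideanSpace ℝ (Fin n))}
    {v : EuclideanSpace ℝ (Fin n)} :
    v ∈ (vectorSpan ℝ F)ᗮ ↔ ∀ x ∈ F, ∀ y ∈ F, inner ℝ v x = (inner ℝ v y : ℝ) := by
  rw [Submodule.mem_orthogonal']
  constructor
  · intro h x hx y hy
    have := h _ (vsub_mem_vectorSpan ℝ hx hy)
    rw [vsub_eq_sub, inner_sub_right] at this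
    linarith
  · intro h w hw
    have hle : vectorSpan ℝ F ≤ LinearMap.ker (innerSL ℝ v).toLinearMap := by
      refine Submodule.span_le.2 ?_
      rintro _ ⟨x, hx, y, hy, rfl⟩
      simp [inner_sub_right, h x hx y hy]
    simpa using hle hw

theorem mem_orthogonal_vectorSpan_supportFace {n : ℕ} (P : Set (EuclideanSpace ℝ (Fin n)))
    (u : EuclideanSpace ℝ (Fin n)) : u ∈ (vectorSpan ℝ (supportFace P u))ᗮ :=
  mem_orthogonal_vectorSpan.2 fun _ hx _ hy => inner_eq_of_mem_supportFace hx hy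

open Filter Topology in
/-- For a polytope, a regular boundary point only lies on a support face of codimension one. -/
theorem finrank_vectorSpan_supportFace {n : ℕ} {P : Set (EuclideanSpace ℝ (Fin n))}
    (hP : IsPolytope P) {u : EuclideanSpace ℝ (Fin n)} (hu : u ∈ normals P) :
    Module.finrank ℝ (vectorSpan ℝ (supportFace P u)) + 1 = n := by
  obtain ⟨s, hs, rfl⟩ := hP
  obtain ⟨y, hy, hyu⟩ := hu
  set P := convexHull ℝ s with hPs
  have hu0 : u ≠ 0 := by
    rw [← norm_ne_zero_iff, hy.1]; exact one_ne_zero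
  -- Tilting `u` slightly along a vector constant on the face keeps `y` maximal: generators on the
  -- face tie with `y`, the others have slack. Regularity of `y` then forces the tilt to be parallel
  -- to `u`.
  have key : (vectorSpan ℝ (supportFace P u))ᗮ = Submodule.span ℝ {u} := by
    refine le_antisymm (fun v hv => ?_) ?_
    swap
    · rw [Submodule.span_singleton_le_iff_mem]
      exact mem_orthogonal_vectorSpan_supportFace P u
    rw [mem_orthogonal_vectorSpan] at hv
    have hev1 : ∀ᶠ e : ℝ in 𝓝[>] 0, ∀ w ∈ s, inner ℝ (u + e • v) w ≤ inner ℝ (u + e • v) y := by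
      refine hs.eventually_all.2 fun w hw => ?_
      have hwP : w ∈ P := subset_convexHull ℝ s hw
      rcases (hy.2.2 w hwP).eq_or_lt with heq | hlt
      · refine Eventually.of_forall fun e => ?_
        have hwF : w ∈ supportFace P u := mem_supportFace_of_inner_eq hwP hy.2 heq
        rw [inner_add_left, inner_add_left, real_inner_smul_left, real_inner_smul_left, heq,
          hv w hwF y hy.2]
      · have hcont : Continuous fun e : ℝ => inner ℝ (u + e • v) (w - y) := by fun_prop
        have hlim := (hcont.tendsto 0).mono_left (nhdsWithin_le_nhds (s := Set.Ioi 0))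
        rw [zero_smul, add_zero, inner_sub_right] at hlim
        filter_upwards [hlim.eventually (gt_mem_nhds (sub_neg.2 hlt))] with e he
        rw [inner_sub_right] at he
        linarith
    have hev2 : ∀ᶠ e : ℝ in 𝓝[>] 0, u + e • v ≠ 0 := by
      have hcont : Continuous fun e : ℝ => u + e • v := by fun_prop
      have hlim := (hcont.tendsto 0).mono_left (nhdsWithin_le_nhds (s := Set.Ioi 0))
      rw [zero_smul, add_zero] at hlim
      exact hlim.eventually_ne hu0
    obtain ⟨e, ⟨he1, he2⟩, he0⟩ := ((hev1.and hev2).and self_mem_nhdsWithin).exists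
    have he0' : e ≠ 0 := (Set.mem_Ioi.1 he0).ne'
    have hpos := norm_pos_iff.2 he2
    have hnormal := hyu (‖u + e • v‖⁻¹ • (u + e • v)) ⟨by
      rw [norm_smul, norm_inv, norm_norm, inv_mul_cancel₀ hpos.ne'], hy.2.1, fun z hz => by
        rw [real_inner_smul_left, real_inner_smul_left]
        exact mul_le_mul_of_nonneg_left (inner_le_of_mem_convexHull he1 hz) (by positivity)⟩
    rw [inv_smul_eq_iff₀ hpos.ne'] at hnormal
    rw [Submodule.mem_span_singleton]
    refine ⟨e⁻¹ * (‖u + e • v‖ - 1), ?_⟩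
    rw [mul_smul, sub_smul, one_smul, ← hnormal, add_sub_cancel_left, inv_smul_smul₀ he0']
  have h1 := (vectorSpan ℝ (supportFace P u)).finrank_add_finrank_orthogonal
  rwa [key, finrank_span_singleton hu0, finrank_euclideanSpace_fin] at h1

open Filter Topology in
/-- A linear functional attaining its maximum at a relative interior point is constant. -/
theorem inner_eq_of_mem_intrinsicInterior {n : ℕ} {F : Set (EuclideanSpace ℝ (Fin n))}
    {y v : EuclideanSpace ℝ (Fin n)} (hy : y ∈ intrinsicInterior ℝ F)
    (hv : ∀ z ∈ F, inner ℝ v z ≤ inner ℝ v y) {z : EuclideanSpace ℝ (Fin n)} (hz : z ∈ F) :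
    inner ℝ v z = (inner ℝ v y : ℝ) := by
  obtain ⟨y', hy', rfl⟩ := mem_intrinsicInterior.1 hy
  refine le_antisymm (hv z hz) ?_
  -- The line from `z` through `y` stays in `F` slightly past `y`, where the functional would exceed
  -- its maximum if it were smaller at `z`.
  let g : ℝ → affineSpan ℝ F := fun t =>
    ⟨AffineMap.lineMap z (y' : EuclideanSpace ℝ (Fin n)) t,
      AffineMap.lineMap_mem t (subset_affineSpan ℝ F hz) y'.2⟩
  have hg : Continuous g := AffineMap.lineMap_continuous.subtype_mk _
  have hg1 : g 1 = y' := Subtype.ext (AffineMap.lineMap_apply_one _ _)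
  have hlim := hg.tendsto 1
  rw [hg1] at hlim
  have hev := (hlim.mono_left (nhdsWithin_le_nhds (s := Set.Ioi 1))).eventually
    (mem_interior_iff_mem_nhds.1 hy')
  obtain ⟨t, ht, ht1⟩ := (hev.and self_mem_nhdsWithin).exists
  have h1 := hv _ ht
  simp only [g, AffineMap.lineMap_apply_module, inner_add_right, real_inner_smul_right] at h1
  have ht1 : 1 < t := ht1
  nlinarith

/-- A functional that is constant on a set with nonempty interior vanishes. -/
theorem eq_zero_of_inner_const {n : ℕ} {P : Set (EuclideanSpace ℝ (Fin n))}
    (hint : (interior P).Nonempty) {u : EuclideanSpace ℝ (Fin n)}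
    (hu : ∀ x ∈ P, ∀ y ∈ P, inner ℝ u x = (inner ℝ u y : ℝ)) : u = 0 := by
  have h1 : vectorSpan ℝ P = ⊤ := by
    rw [← direction_affineSpan, affineSpan_eq_top_of_nonempty_interior, AffineSubspace.direction_top]
    exact hint.mono (interior_mono (subset_convexHull ℝ P))
  have h2 := mem_orthogonal_vectorSpan.2 hu
  rwa [h1, Submodule.top_orthogonal_eq_bot, Submodule.mem_bot] at h2

/-- A unit vector whose support face has codimension one is a facet normal. -/
theorem mem_normals_of_finrank_supportFace {n : ℕ} {P : Set (EuclideanSpace ℝ (Fin n))}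
    (hconv : Convex ℝ P) (hint : (interior P).Nonempty) {u : EuclideanSpace ℝ (Fin n)}
    (hu : ‖u‖ = 1) (hne : (supportFace P u).Nonempty)
    (hrank : Module.finrank ℝ (vectorSpan ℝ (supportFace P u)) + 1 = n) : u ∈ normals P := by
  have hu0 : u ≠ 0 := by
    rw [← norm_ne_zero_iff, hu]; exact one_ne_zero
  obtain ⟨y, hy⟩ := Set.Nonempty.intrinsicInterior ((isExposed_supportFace P u).convex hconv) hne
  have hyF := intrinsicInterior_subset hy
  refine ⟨y, ⟨hu, hyF⟩, fun v hv => ?_⟩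
  have hvF : v ∈ (vectorSpan ℝ (supportFace P u))ᗮ := by
    have := fun z (hz : z ∈ supportFace P u) =>
      inner_eq_of_mem_intrinsicInterior (v := v) hy (fun z hz => hv.2.2 z hz.1) hz
    exact mem_orthogonal_vectorSpan.2 fun a ha b hb => (this a ha).trans (this b hb).symm
  have h1 : Module.finrank ℝ (vectorSpan ℝ (supportFace P u))ᗮ = 1 := by
    have := (vectorSpan ℝ (supportFace P u)).finrank_add_finrank_orthogonal
    rw [finrank_euclideanSpace_fin] at this
    omega
  obtain ⟨c, hc⟩ := (finrank_eq_one_iff_of_nonzero' (⟨u, mem_orthogonal_vectorSpan_supportFace P u⟩ :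
    (vectorSpan ℝ (supportFace P u))ᗮ) (by simpa [Subtype.ext_iff] using hu0)).1 h1 ⟨v, hvF⟩
  replace hc : c • u = v := congrArg Subtype.val hc
  have hc1 : |c| = 1 := by
    have := hv.1
    rwa [← hc, norm_smul, hu, mul_one, Real.norm_eq_abs] at this
  -- The sign `-1` would make `u` both maximal and minimal at `y`, hence constant on a set with
  -- interior.
  rcases eq_or_eq_neg_of_abs_eq hc1 with rfl | rfl
  · rw [← hc, one_smul]
  · exfalso
    have hconst : ∀ x ∈ P, inner ℝ u x = (inner ℝ u y : ℝ) := fun x hx => by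
      have := hv.2.2 x hx
      rw [← hc, real_inner_smul_left, real_inner_smul_left] at this
      exact le_antisymm (hyF.2 x hx) (by linarith)
    exact hu0 (eq_zero_of_inner_const hint fun a ha b hb =>
      (hconst a ha).trans (hconst b hb).symm)

theorem eq_of_supportFace_eq {n : ℕ} {P : Set (EuclideanSpace ℝ (Fin n))}
    {u v : EuclideanSpace ℝ (Fin n)} (hu : u ∈ normals P) (hv : ‖v‖ = 1)
    (h : supportFace P u = supportFace P v) : u = v := by
  obtain ⟨y, hy, hyu⟩ := hu
  have hyv : y ∈ supportFace P v := h ▸ hy.2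
  exact (hyu v ⟨hv, hyv⟩).symm

theorem IsPolytope.isCompact {n : ℕ} {P : Set (EuclideanSpace ℝ (Fin n))} (hP : IsPolytope P) :
    IsCompact P := by
  obtain ⟨s, hs, rfl⟩ := hP
  exact hs.isCompact_convexHull (𝕜 := ℝ)

theorem IsPolytope.convex {n : ℕ} {P : Set (EuclideanSpace ℝ (Fin n))} (hP : IsPolytope P) :
    Convex ℝ P := by
  obtain ⟨s, -, rfl⟩ := hP
  exact convex_convexHull ℝ s

theorem IsPolytope.finite_extremePoints {n : ℕ} {P : Set (EuclideanSpace ℝ (Fin n))}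
    (hP : IsPolytope P) : (P.extremePoints ℝ).Finite := by
  obtain ⟨s, hs, rfl⟩ := hP
  exact hs.subset extremePoints_convexHull_subset

theorem IsPolytope.convexHull_extremePoints {n : ℕ} {P : Set (EuclideanSpace ℝ (Fin n))}
    (hP : IsPolytope P) : convexHull ℝ (P.extremePoints ℝ) = P := by
  have := closure_convexHull_extremePoints hP.isCompact hP.convex
  rwa [(hP.finite_extremePoints.isClosed_convexHull (𝕜 := ℝ)).closure_eq] at this

/-- A support face is the hull of the extreme points it contains, and a facet normal is determined
by its face; so facet normals inject into the subsets of a finite set. -/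
theorem IsPolytope.finite_normals {n : ℕ} {P : Set (EuclideanSpace ℝ (Fin n))}
    (hP : IsPolytope P) : (normals P).Finite := by
  have hext : ∀ u, supportFace P u =
      closure (convexHull ℝ (supportFace P u ∩ P.extremePoints ℝ)) := fun u => by
    have hexp := isExposed_supportFace P u
    rw [← hexp.isExtreme.extremePoints_eq]
    exact (closure_convexHull_extremePoints (hexp.isCompact hP.isCompact)
      (hexp.convex hP.convex)).symm
  refine Set.Finite.of_finite_image (f := fun u => supportFace P u ∩ P.extremePoints ℝ)
    (hP.finite_extremePoints.finite_subsets.subset ?_) fun u hu v hv huv => ?_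
  · rintro _ ⟨u, -, rfl⟩
    exact Set.inter_subset_right
  · refine eq_of_supportFace_eq hu (hv.choose_spec.1.1) ?_
    have huv' : supportFace P u ∩ P.extremePoints ℝ = supportFace P v ∩ P.extremePoints ℝ := huv
    rw [hext u, hext v, huv']

/-! ### Polytopes with few facets are simplices -/

open Filter Topology in
/-- The normals of the facets through an extreme point of a polyhedron span the space. -/
theorem span_tight_eq_top {n : ℕ} {P H : Set (EuclideanSpace ℝ (Fin n))} (hH : H.Finite)
    {h : EuclideanSpace ℝ (Fin n) → ℝ} (hP : ∀ x, x ∈ P ↔ ∀ u ∈ H, inner ℝ u x ≤ h u)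
    {x : EuclideanSpace ℝ (Fin n)} (hx : x ∈ P.extremePoints ℝ) :
    Submodule.span ℝ {u ∈ H | inner ℝ u x = h u} = ⊤ := by
  rw [← Submodule.orthogonal_eq_bot_iff, Submodule.eq_bot_iff]
  intro d hd
  rw [Submodule.mem_orthogonal] at hd
  have hxP := (hP x).1 hx.1
  have hmove : ∀ d : EuclideanSpace ℝ (Fin n), (∀ u ∈ H, inner ℝ u x = h u → inner ℝ u d = (0 : ℝ)) →
      ∀ᶠ e : ℝ in 𝓝[>] 0, x + e • d ∈ P := fun d hd => by
    simp only [hP]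
    refine hH.eventually_all.2 fun u hu => ?_
    rcases (hxP u hu).eq_or_lt with heq | hlt
    · refine Eventually.of_forall fun e => ?_
      rw [inner_add_right, real_inner_smul_right, hd u hu heq, mul_zero, add_zero, heq]
    · have hcont : Continuous fun e : ℝ => inner ℝ u (x + e • d) := by fun_prop
      have hlim := (hcont.tendsto 0).mono_left (nhdsWithin_le_nhds (s := Set.Ioi 0))
      rw [zero_smul, add_zero] at hlim
      exact (hlim.eventually (gt_mem_nhds hlt)).mono fun e he => he.le
  have hd' : ∀ u ∈ H, inner ℝ u x = h u → inner ℝ u d = (0 : ℝ) := fun u hu hux =>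
    hd u (Submodule.subset_span ⟨hu, hux⟩)
  -- A direction orthogonal to all tight normals can be followed both ways inside `P`, so
  -- extremality makes it zero.
  obtain ⟨e, ⟨he1, he2⟩, he0⟩ := (((hmove d hd').and (hmove (-d) fun u hu hux => by
    rw [inner_neg_right, hd' u hu hux, neg_zero])).and self_mem_nhdsWithin).exists
  have he0 : 0 < e := he0
  have := hx.2 he1 he2 ⟨1 / 2, 1 / 2, by norm_num, by norm_num, by norm_num, by module⟩
  simpa [he0.ne'] using this

/-- A full-dimensional polytope with at most `n + 1` facets is a simplex. -/
theorem IsPolytope.isSimplex_of_ncard_normals_le {n : ℕ} {P : Set (EuclideanSpace ℝ (Fin n))}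
    (hP : IsPolytope P) (hint : (interior P).Nonempty) (hn : 0 < n)
    (hcard : (normals P).ncard ≤ n + 1) : IsSimplex P := by
  obtain ⟨h, q, hPh, hq⟩ := exists_facet_representation hP.isCompact.isClosed hP.convex hint
  set H := normals P with hH
  have hHf : H.Finite := hP.finite_normals
  set E := P.extremePoints ℝ with hE
  have hEf : E.Finite := hP.finite_extremePoints
  have hspan := fun x (hx : x ∈ E) => span_tight_eq_top hHf hPh hx
  obtain ⟨z, hz⟩ := hint
  have hzs : ∀ u ∈ H, inner ℝ u z < h u := fun u hu => by
    obtain ⟨r, hr, hrP⟩ := Metric.nhds_basis_closedBall.mem_iff.1 (mem_interior_iff_mem_nhds.1 hz)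
    have hv : IsOuterNormalAt P (q u) u := ⟨hu.choose_spec.1.1, (hq u hu).1, fun y hy => by
      rw [(hq u hu).2.1]
      exact (hPh y).1 hy u hu⟩
    have := hv.le_inner_sub hr.le hrP
    rw [inner_sub_right, (hq u hu).2.1] at this
    linarith
  have hHne : H.Nonempty := by
    by_contra hne
    rw [Set.not_nonempty_iff_eq_empty] at hne
    have hEne : E.Nonempty := hP.isCompact.extremePoints_nonempty ⟨z, interior_subset hz⟩
    obtain ⟨x, hx⟩ := hEne
    have h1 := hspan x hx
    rw [hne] at h1
    simp only [Set.mem_empty_iff_false, false_and, Set.ofPred_false, Submodule.span_empty] at h1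
    have h2 := congrArg (fun W : Submodule ℝ (EuclideanSpace ℝ (Fin n)) => Module.finrank ℝ W) h1
    simp only [finrank_bot, finrank_top, finrank_euclideanSpace_fin] at h2
    omega
  -- At a vertex on all facets, every normal would be negative on `z - x`, although `0` is in their
  -- convex hull.
  have hloose : ∀ x ∈ E, ∃ u ∈ H, inner ℝ u x ≠ h u := fun x hx => by
    by_contra! hall
    have h0 := zero_mem_convexHull_of_isBounded hP.isCompact.isBounded ⟨z, interior_subset hz⟩
      hHf hHne hPh
    have hconv : Convex ℝ {u : EuclideanSpace ℝ (Fin n) | inner ℝ u (z - x) < 0} :=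
      convex_halfSpace_lt ⟨fun _ _ => inner_add_left _ _ _, fun _ _ => real_inner_smul_left _ _ _⟩ _
    have := convexHull_min (fun u hu => ?_) hconv h0
    · simp at this
    · rw [Set.mem_ofPred_eq, inner_sub_right, hall u hu]
      linarith [hzs u hu]
  choose! g hgH hg using hloose
  -- Spanning requires at least `n` tight normals, and at most `n + 1` exist, so exactly one is
  -- loose. It determines the vertex, because the tight ones span; hence there are at most `n + 1`
  -- vertices.
  have htight : ∀ x ∈ E, {u ∈ H | inner ℝ u x = h u} = H \ {g x} := fun x hx => by
    have hsub : {u ∈ H | inner ℝ u x = h u} ⊆ H \ {g x} := fun u hu =>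
      ⟨hu.1, fun hux => hg x hx (by rw [← Set.mem_singleton_iff.1 hux]; exact hu.2)⟩
    refine Set.eq_of_subset_of_ncard_le hsub ?_ (hHf.subset Set.sdiff_subset)
    rw [Set.ncard_sdiff_singleton_of_mem (hgH x hx)]
    have hfin : ({u ∈ H | inner ℝ u x = h u}).Finite := hHf.subset fun u hu => hu.1
    have := hfin.fintype
    have h1 := finrank_span_le_card (R := ℝ) {u ∈ H | inner ℝ u x = h u}
    rw [hspan x hx, finrank_top, finrank_euclideanSpace_fin, ← Set.ncard_eq_toFinset_card'] at h1
    omega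
  have hginj : Set.InjOn g E := fun x hx y hy hxy => by
    have h1 : ∀ u ∈ ({u ∈ H | inner ℝ u x = h u} : Set (EuclideanSpace ℝ (Fin n))),
        inner ℝ u (x - y) = (0 : ℝ) := fun u hu => by
      have hu' := hu
      rw [htight x hx, hxy, ← htight y hy] at hu'
      rw [inner_sub_right, hu.2, hu'.2, sub_self]
    have h2 : x - y ∈ (Submodule.span ℝ {u ∈ H | inner ℝ u x = h u})ᗮ := by
      rw [Submodule.mem_orthogonal]
      intro u hu
      induction hu using Submodule.span_induction with
      | mem u hu => exact h1 u hu
      | zero => exact inner_zero_left _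
      | add u v _ _ hu hv => rw [inner_add_left, hu, hv, add_zero]
      | smul c u _ hu => rw [real_inner_smul_left, hu, mul_zero]
    rw [hspan x hx, Submodule.top_orthogonal_eq_bot, Submodule.mem_bot, sub_eq_zero] at h2
    exact h2
  have hEcard : E.ncard ≤ n + 1 := (Set.ncard_le_ncard_of_injOn g hgH hginj hHf).trans hcard
  have hEspan : Module.finrank ℝ (vectorSpan ℝ E) = n := by
    rw [← direction_affineSpan, affineSpan_eq_top_of_nonempty_interior,
      AffineSubspace.direction_top, finrank_top, finrank_euclideanSpace_fin]
    rw [hP.convexHull_extremePoints]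
    exact ⟨z, hz⟩
  have : Fintype E := hEf.fintype
  have hcE : Fintype.card E = E.ncard := Nat.card_eq_fintype_card.symm
  have hcE' : Fintype.card E = n + 1 := by
    refine le_antisymm (hcE ▸ hEcard) ?_
    obtain ⟨m, hm⟩ : ∃ m, Fintype.card E = m + 1 := by
      obtain ⟨x, hx⟩ : E.Nonempty := hP.isCompact.extremePoints_nonempty ⟨z, interior_subset hz⟩
      exact Nat.exists_eq_add_one.2 (Fintype.card_pos_iff.2 ⟨⟨x, hx⟩⟩)
    have := finrank_vectorSpan_range_le ℝ ((↑) : E → EuclideanSpace ℝ (Fin n)) hm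
    rw [Subtype.range_coe, hEspan] at this
    omega
  let eq := Fintype.equivFinOfCardEq hcE'
  refine ⟨n, ⟨fun i => (eq.symm i : EuclideanSpace ℝ (Fin n)), ?_⟩, ?_⟩
  · have := (affineIndependent_iff_finrank_vectorSpan_eq ℝ
      ((↑) : E → EuclideanSpace ℝ (Fin n)) hcE').2 (by rw [Subtype.range_coe, hEspan])
    exact this.comp_embedding eq.symm.toEmbedding
  · have : Set.range (fun i => (eq.symm i : EuclideanSpace ℝ (Fin n))) = E := by
      rw [← Function.comp_def, Set.range_comp, eq.symm.range_eq_univ, Set.image_univ,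
        Subtype.range_coe]
    rw [this, hP.convexHull_extremePoints]

/-! ### Faces of a pyramid -/

theorem finrank_vectorSpan_insert_of_notMem {n : ℕ} {G : Set (EuclideanSpace ℝ (Fin n))}
    (hG : G.Nonempty) {p : EuclideanSpace ℝ (Fin n)} (hp : p ∉ affineSpan ℝ G) :
    Module.finrank ℝ (vectorSpan ℝ (insert p G)) = Module.finrank ℝ (vectorSpan ℝ G) + 1 := by
  refine le_antisymm (finrank_vectorSpan_insert_le_set ℝ G p) (Submodule.finrank_lt_finrank_of_lt
    (lt_of_le_of_ne (vectorSpan_mono ℝ (Set.subset_insert p G)) fun heq => hp ?_))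
  obtain ⟨g, hg⟩ := hG
  have h1 : p -ᵥ g ∈ vectorSpan ℝ G := by
    rw [heq]
    exact vsub_mem_vectorSpan ℝ (Set.mem_insert p G) (Set.mem_insert_of_mem p hg)
  have h2 := vadd_mem_affineSpan_of_mem_affineSpan_of_mem_vectorSpan
    (subset_affineSpan ℝ G hg) h1
  rwa [vsub_vadd] at h2

theorem mem_convexHull_insert {n : ℕ} {B : Set (EuclideanSpace ℝ (Fin n))} (hB : Convex ℝ B)
    (hne : B.Nonempty) {p x : EuclideanSpace ℝ (Fin n)} (hx : x ∈ convexHull ℝ (insert p B)) :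
    ∃ b ∈ B, ∃ s t : ℝ, 0 ≤ s ∧ 0 ≤ t ∧ s + t = 1 ∧ s • p + t • b = x := by
  rw [convexHull_insert hne, hB.convexHull_eq, mem_convexJoin] at hx
  obtain ⟨a, ha, b, hb, s, t, hs, ht, hst, h⟩ := hx
  rw [Set.mem_singleton_iff.1 ha] at h
  exact ⟨b, hb, s, t, hs, ht, hst, h⟩

theorem supportFace_smul {n : ℕ} (P : Set (EuclideanSpace ℝ (Fin n)))
    (u : EuclideanSpace ℝ (Fin n)) {r : ℝ} (hr : 0 < r) :
    supportFace P (r • u) = supportFace P u := by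
  simp only [supportFace, real_inner_smul_left, mul_le_mul_iff_right₀ hr]

/-- A face of a pyramid contains the apex or lies in the base. -/
theorem apex_mem_supportFace_or_subset {n : ℕ} {B : Set (EuclideanSpace ℝ (Fin n))}
    (hB : Convex ℝ B) (hne : B.Nonempty) (p u : EuclideanSpace ℝ (Fin n)) :
    p ∈ supportFace (convexHull ℝ (insert p B)) u ∨
      supportFace (convexHull ℝ (insert p B)) u ⊆ B := by
  by_cases hp : p ∈ supportFace (convexHull ℝ (insert p B)) u
  · exact Or.inl hp
  refine Or.inr fun x hx => ?_
  obtain ⟨b, hb, s, t, hs, ht, hst, rfl⟩ := mem_convexHull_insert hB hne hx.1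
  have hpP : p ∈ convexHull ℝ (insert p B) := subset_convexHull ℝ _ (Set.mem_insert p B)
  have hbP : b ∈ convexHull ℝ (insert p B) :=
    subset_convexHull ℝ _ (Set.mem_insert_of_mem p hb)
  rcases hs.eq_or_lt with rfl | hs
  · rw [zero_add] at hst
    rwa [zero_smul, zero_add, hst, one_smul]
  -- A maximum attained at a point with positive weight on the apex is attained at the apex too.
  · refine absurd (mem_supportFace_of_inner_eq hpP hx (le_antisymm (hx.2 p hpP) ?_)) hp
    have h1 := hx.2 b hbP
    rw [inner_add_right, real_inner_smul_right, real_inner_smul_right] at h1 ⊢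
    have ht' : t = 1 - s := by linarith
    subst ht'
    nlinarith

/-- A face of a pyramid through the apex is the pyramid over its intersection with the base. -/
theorem supportFace_eq_convexHull_insert {n : ℕ} {B : Set (EuclideanSpace ℝ (Fin n))}
    (hB : Convex ℝ B) (hne : B.Nonempty) {p u : EuclideanSpace ℝ (Fin n)}
    (hp : p ∈ supportFace (convexHull ℝ (insert p B)) u) :
    supportFace (convexHull ℝ (insert p B)) u =
      convexHull ℝ (insert p (supportFace (convexHull ℝ (insert p B)) u ∩ B)) := by
  refine Set.Subset.antisymm (fun x hx => ?_) (convexHull_min (Set.insert_subset hp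
    Set.inter_subset_left) ((isExposed_supportFace _ u).convex (convex_convexHull ℝ _)))
  obtain ⟨b, hb, s, t, hs, ht, hst, rfl⟩ := mem_convexHull_insert hB hne hx.1
  have hbP : b ∈ convexHull ℝ (insert p B) :=
    subset_convexHull ℝ _ (Set.mem_insert_of_mem p hb)
  set F := supportFace (convexHull ℝ (insert p B)) u with hF
  have hpm : p ∈ convexHull ℝ (insert p (F ∩ B)) :=
    subset_convexHull ℝ _ (Set.mem_insert p _)
  rcases ht.eq_or_lt with rfl | ht
  · rw [add_zero] at hst
    rwa [zero_smul, add_zero, hst, one_smul]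
  · have h1 := inner_eq_of_mem_supportFace hx hp
    rw [inner_add_right, real_inner_smul_right, real_inner_smul_right] at h1
    have hs' : s = 1 - t := by linarith
    have h2 : t * (inner ℝ u b - inner ℝ u p) = 0 := by rw [hs'] at h1; linarith
    have hbF : b ∈ F := mem_supportFace_of_inner_eq hbP hp
      (sub_eq_zero.1 ((mul_eq_zero.1 h2).resolve_left ht.ne'))
    exact convex_convexHull ℝ _ hpm
      (subset_convexHull ℝ _ (Set.mem_insert_of_mem p ⟨hbF, hb⟩)) hs ht.le hst

theorem isPolytope_convexHull_insert {n : ℕ} {B : Set (EuclideanSpace ℝ (Fin n))}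
    (hB : IsPolytope B) (p : EuclideanSpace ℝ (Fin n)) :
    IsPolytope (convexHull ℝ (insert p B)) := by
  obtain ⟨s, hs, rfl⟩ := hB
  refine ⟨insert p s, hs.insert p, ?_⟩
  rw [Set.insert_eq, Set.insert_eq, convexHull_convexHull_union_right]

theorem vectorSpan_insert_eq_top {n : ℕ} {B : Set (EuclideanSpace ℝ (Fin n))}
    (hne : B.Nonempty) (hrank : Module.finrank ℝ (vectorSpan ℝ B) + 1 = n)
    {p : EuclideanSpace ℝ (Fin n)} (hp : p ∉ affineSpan ℝ B) :
    vectorSpan ℝ (insert p B) = ⊤ :=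
  Submodule.eq_top_of_finrank_eq (by
    rw [finrank_vectorSpan_insert_of_notMem hne hp, hrank, finrank_euclideanSpace_fin])

theorem interior_convexHull_insert_nonempty {n : ℕ} {B : Set (EuclideanSpace ℝ (Fin n))}
    (hne : B.Nonempty) (hrank : Module.finrank ℝ (vectorSpan ℝ B) + 1 = n)
    {p : EuclideanSpace ℝ (Fin n)} (hp : p ∉ affineSpan ℝ B) :
    (interior (convexHull ℝ (insert p B))).Nonempty := by
  rw [interior_convexHull_nonempty_iff_affineSpan_eq_top,
    AffineSubspace.affineSpan_eq_top_iff_vectorSpan_eq_top_of_nonempty _ _ _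
      (Set.insert_nonempty p B)]
  exact vectorSpan_insert_eq_top hne hrank hp

/-- The unit normal of the hyperplane spanned by the base, pointing away from the apex. -/
theorem exists_base_normal {n : ℕ} {B : Set (EuclideanSpace ℝ (Fin n))}
    (hne : B.Nonempty) (hrank : Module.finrank ℝ (vectorSpan ℝ B) + 1 = n)
    {p : EuclideanSpace ℝ (Fin n)} (hp : p ∉ affineSpan ℝ B) :
    ∃ (u : EuclideanSpace ℝ (Fin n)) (c : ℝ), ‖u‖ = 1 ∧ (∀ b ∈ B, inner ℝ u b = c) ∧
      inner ℝ u p < c := by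
  obtain ⟨b₀, hb₀⟩ := hne
  obtain ⟨w, hw, hwne⟩ : ∃ w ∈ (vectorSpan ℝ B)ᗮ, w ≠ 0 := by
    refine (Submodule.ne_bot_iff _).1 fun hbot => ?_
    have h1 := (vectorSpan ℝ B).finrank_add_finrank_orthogonal
    rw [hbot, finrank_bot, finrank_euclideanSpace_fin] at h1
    omega
  rw [mem_orthogonal_vectorSpan] at hw
  have hwp : inner ℝ w p ≠ (inner ℝ w b₀ : ℝ) := fun heq => hwne (by
    have h1 : w ∈ (vectorSpan ℝ (insert p B))ᗮ := mem_orthogonal_vectorSpan.2 (by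
      have h2 : ∀ x ∈ insert p B, inner ℝ w x = (inner ℝ w b₀ : ℝ) := by
        rintro x (rfl | hx)
        · exact heq
        · exact hw x hx b₀ hb₀
      exact fun x hx y hy => (h2 x hx).trans (h2 y hy).symm)
    rwa [vectorSpan_insert_eq_top ⟨b₀, hb₀⟩ hrank hp, Submodule.top_orthogonal_eq_bot,
      Submodule.mem_bot] at h1)
  obtain ⟨v, hvB, hvp⟩ : ∃ v : EuclideanSpace ℝ (Fin n),
      (∀ b ∈ B, inner ℝ v b = (inner ℝ v b₀ : ℝ)) ∧ inner ℝ v p < (inner ℝ v b₀ : ℝ) := by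
    rcases hwp.lt_or_gt with hlt | hgt
    · exact ⟨w, fun b hb => hw b hb b₀ hb₀, hlt⟩
    · refine ⟨-w, fun b hb => ?_, ?_⟩
      · rw [inner_neg_left, inner_neg_left, hw b hb b₀ hb₀]
      · rw [inner_neg_left, inner_neg_left]
        exact neg_lt_neg hgt
  have hv0 : v ≠ 0 := by
    rintro rfl
    simp at hvp
  have hpos := norm_pos_iff.2 hv0
  refine ⟨‖v‖⁻¹ • v, ‖v‖⁻¹ * inner ℝ v b₀, ?_, fun b hb => ?_, ?_⟩
  · rw [norm_smul, norm_inv, norm_norm, inv_mul_cancel₀ hpos.ne']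
  · rw [real_inner_smul_left, hvB b hb]
  · rw [real_inner_smul_left]
    exact mul_lt_mul_of_pos_left hvp (inv_pos.2 hpos)

theorem supportFace_base_normal {n : ℕ} {B : Set (EuclideanSpace ℝ (Fin n))}
    (hB : Convex ℝ B) (hne : B.Nonempty) {p u : EuclideanSpace ℝ (Fin n)} {c : ℝ}
    (huB : ∀ b ∈ B, inner ℝ u b = c) (hup : inner ℝ u p < c) :
    supportFace (convexHull ℝ (insert p B)) u = B := by
  have hle : ∀ y ∈ convexHull ℝ (insert p B), inner ℝ u y ≤ c := fun y hy =>
    inner_le_of_mem_convexHull (by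
      rintro x (rfl | hx)
      · exact hup.le
      · exact (huB x hx).le) hy
  refine Set.Subset.antisymm ?_ fun b hb => ⟨subset_convexHull ℝ _ (Set.mem_insert_of_mem p hb),
    fun y hy => (hle y hy).trans (huB b hb).ge⟩
  refine (apex_mem_supportFace_or_subset hB hne p u).resolve_left fun hp => ?_
  obtain ⟨b, hb⟩ := hne
  have := hp.2 b (subset_convexHull ℝ _ (Set.mem_insert_of_mem p hb))
  rw [huB b hb] at this
  linarith

/-- A facet normal of a pyramid other than that of the base is a normal at the apex. -/
theorem apex_mem_supportFace_of_ne {n : ℕ} {B : Set (EuclideanSpace ℝ (Fin n))}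
    (hB : Convex ℝ B) (hne : B.Nonempty) {p u₀ u : EuclideanSpace ℝ (Fin n)}
    (hu₀ : ‖u₀‖ = 1) (hface : supportFace (convexHull ℝ (insert p B)) u₀ = B)
    (hu : u ∈ normals (convexHull ℝ (insert p B))) (huu : u ≠ u₀) :
    p ∈ supportFace (convexHull ℝ (insert p B)) u := by
  refine (apex_mem_supportFace_or_subset hB hne p u).resolve_right fun hsub => huu ?_
  obtain ⟨y, hy, hyu⟩ := hu
  have hyB : y ∈ supportFace (convexHull ℝ (insert p B)) u₀ := hface.symm ▸ hsub hy.2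
  exact (hyu u₀ ⟨hu₀, hyB⟩).symm

/-- The facets of a pyramid other than the base correspond to the relative facets of the base. -/
theorem image_supportFace_inter_eq_relativeFacets {n : ℕ} {B : Set (EuclideanSpace ℝ (Fin n))}
    (hn : 1 < n) (hB : IsPolytope B) (hne : B.Nonempty)
    (hrank : Module.finrank ℝ (vectorSpan ℝ B) + 1 = n)
    {p u₀ : EuclideanSpace ℝ (Fin n)} (hp : p ∉ affineSpan ℝ B) {c : ℝ} (hu₀ : ‖u₀‖ = 1)
    (huB : ∀ b ∈ B, inner ℝ u₀ b = c) (hup : inner ℝ u₀ p < c) :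
    (fun u => supportFace (convexHull ℝ (insert p B)) u ∩ B) ''
      (normals (convexHull ℝ (insert p B)) \ {u₀}) = relativeFacets B := by
  have hface := supportFace_base_normal hB.convex hne huB hup
  set P := convexHull ℝ (insert p B) with hP
  have hPp : IsPolytope P := isPolytope_convexHull_insert hB p
  have hint : (interior P).Nonempty := interior_convexHull_insert_nonempty hne hrank hp
  have hpP : p ∈ P := subset_convexHull ℝ _ (Set.mem_insert p B)
  have hBP : B ⊆ P := (Set.subset_insert p B).trans (subset_convexHull ℝ _)
  have hspan : ∀ u, p ∈ supportFace P u → vectorSpan ℝ (supportFace P u) =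
      vectorSpan ℝ (insert p (supportFace P u ∩ B)) := fun u hpu => by
    rw [supportFace_eq_convexHull_insert hB.convex hne hpu, ← direction_affineSpan,
      affineSpan_convexHull, direction_affineSpan, ← supportFace_eq_convexHull_insert
      hB.convex hne hpu]
  have hnot : ∀ G ⊆ B, p ∉ affineSpan ℝ G := fun G hG h => hp (affineSpan_mono ℝ hG h)
  refine Set.Subset.antisymm ?_ ?_
  · rintro _ ⟨u, ⟨hu, huu⟩, rfl⟩
    have hpu : p ∈ supportFace P u := apex_mem_supportFace_of_ne hB.convex hne hu₀ hface hu huu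
    have hr := finrank_vectorSpan_supportFace hPp hu
    rw [hspan u hpu] at hr
    -- Otherwise the facet would be the apex alone, forcing `n = 1`.
    have hGne : (supportFace P u ∩ B).Nonempty := by
      by_contra h
      rw [Set.not_nonempty_iff_eq_empty] at h
      rw [h, insert_empty_eq, vectorSpan_singleton, finrank_bot] at hr
      omega
    rw [finrank_vectorSpan_insert_of_notMem hGne (hnot _ Set.inter_subset_right)] at hr
    refine ⟨hGne, fun ⟨g, hg⟩ => ⟨innerSL ℝ u, ?_⟩, by dsimp only; omega⟩
    refine Set.Subset.antisymm (fun x hx => ⟨hx.2, fun y hy => hx.1.2 y (hBP hy)⟩) fun x hx => ?_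
    exact ⟨mem_supportFace_of_inner_eq (hBP hx.1) hg.1
      (le_antisymm (hg.1.2 x (hBP hx.1)) (hx.2 g hg.2)), hx.1⟩
  · rintro G ⟨⟨g, hg⟩, hGe, hGr⟩
    obtain ⟨l, hl⟩ := hGe ⟨g, hg⟩
    set a := (InnerProductSpace.toDual ℝ (EuclideanSpace ℝ (Fin n))).symm l with ha
    have hla : ∀ z, l z = inner ℝ a z := fun z => by
      rw [ha, InnerProductSpace.toDual_symm_apply]
    simp only [hla] at hl
    have hgB : g ∈ B := hGe.subset hg
    have hGmem : ∀ b ∈ B, b ∈ G ↔ inner ℝ a b = (inner ℝ a g : ℝ) := fun b hb => by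
      rw [hl] at hg ⊢
      exact ⟨fun h => le_antisymm (hg.2 b hb) (h.2 g hgB), fun h => ⟨hb, fun y hy =>
        (hg.2 y hy).trans h.ge⟩⟩
    have hmax : ∀ b ∈ B, inner ℝ a b ≤ (inner ℝ a g : ℝ) := by
      rw [hl] at hg
      exact hg.2
    -- Adding a multiple of `u₀`, constant on `B`, does not change which points of `B` are maximal;
    -- this `r` tilts the supporting hyperplane until it passes through the apex.
    set r := (inner ℝ a p - inner ℝ a g : ℝ) / (c - inner ℝ u₀ p) with hr
    set w := a + r • u₀ with hw
    have hwp : inner ℝ w p = inner ℝ a g + r * c := by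
      have : r * (c - inner ℝ u₀ p) = inner ℝ a p - inner ℝ a g :=
        div_mul_cancel₀ _ (sub_pos.2 hup).ne'
      rw [hw, inner_add_left, real_inner_smul_left]
      linarith
    have hwB : ∀ b ∈ B, inner ℝ w b = inner ℝ a b + r * c := fun b hb => by
      rw [hw, inner_add_left, real_inner_smul_left, huB b hb]
    have hpw : p ∈ supportFace P w := ⟨hpP, fun y hy => inner_le_of_mem_convexHull (by
      rintro x (rfl | hx)
      · exact le_rfl
      · rw [hwp, hwB x hx]
        linarith [hmax x hx]) hy⟩
    have hGw : supportFace P w ∩ B = G := by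
      ext b
      constructor
      · rintro ⟨hb, hbB⟩
        have := inner_eq_of_mem_supportFace hb hpw
        rw [hwp, hwB b hbB] at this
        exact (hGmem b hbB).2 (by linarith)
      · intro hb
        have hbB := hGe.subset hb
        refine ⟨mem_supportFace_of_inner_eq (hBP hbB) hpw ?_, hbB⟩
        rw [hwp, hwB b hbB, (hGmem b hbB).1 hb]
    have hw0 : w ≠ 0 := by
      intro h0
      have hPw : B ⊆ supportFace P w := fun b hb => ⟨hBP hb, fun y _ => by simp [h0]⟩
      rw [Set.inter_eq_right.2 hPw] at hGw
      rw [hGw] at hGr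
      omega
    have hpos := norm_pos_iff.2 hw0
    have hnface := supportFace_smul P w (inv_pos.2 hpos)
    refine ⟨‖w‖⁻¹ • w, ⟨?_, ?_⟩, ?_⟩
    · refine mem_normals_of_finrank_supportFace hPp.convex hint ?_ ?_ ?_
      · rw [norm_smul, norm_inv, norm_norm, inv_mul_cancel₀ hpos.ne']
      · rw [hnface]
        exact ⟨p, hpw⟩
      · rw [hnface, hspan w hpw, hGw, finrank_vectorSpan_insert_of_notMem ⟨g, hg⟩
          (hnot G hGe.subset), hGr, hrank]
    · intro heq
      have hpB : p ∈ B := by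
        rw [← hface, ← Set.mem_singleton_iff.1 heq, hnface]
        exact hpw
      exact hp (subset_affineSpan ℝ B hpB)
    · simp only [hnface, hGw]

/-- A lateral facet is recovered from its trace on `B` as the pyramid over it, and the facet
determines its normal. -/
theorem injOn_supportFace_inter {n : ℕ} {B : Set (EuclideanSpace ℝ (Fin n))}
    (hB : Convex ℝ B) (hne : B.Nonempty) {p u₀ : EuclideanSpace ℝ (Fin n)}
    (hu₀ : ‖u₀‖ = 1) (hface : supportFace (convexHull ℝ (insert p B)) u₀ = B) :
    Set.InjOn (fun u => supportFace (convexHull ℝ (insert p B)) u ∩ B)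
      (normals (convexHull ℝ (insert p B)) \ {u₀}) := fun u hu v hv huv => by
  have huv : supportFace (convexHull ℝ (insert p B)) u ∩ B =
    supportFace (convexHull ℝ (insert p B)) v ∩ B := huv
  refine eq_of_supportFace_eq hu.1 hv.1.choose_spec.1.1 ?_
  rw [supportFace_eq_convexHull_insert hB hne
      (apex_mem_supportFace_of_ne hB hne hu₀ hface hu.1 hu.2),
    supportFace_eq_convexHull_insert hB hne
      (apex_mem_supportFace_of_ne hB hne hu₀ hface hv.1 hv.2), huv]

/-- The pyramid over a point is a segment; this rules out `n = 1` in the theorem. -/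
theorem isSimplex_convexHull_insert_of_finrank_eq_zero {n : ℕ}
    {B : Set (EuclideanSpace ℝ (Fin n))} (hne : B.Nonempty)
    (hrank : Module.finrank ℝ (vectorSpan ℝ B) = 0) {p : EuclideanSpace ℝ (Fin n)}
    (hp : p ∉ affineSpan ℝ B) : IsSimplex (convexHull ℝ (insert p B)) := by
  obtain ⟨b, hb⟩ := hne
  have hB : B = {b} := by
    refine Set.eq_singleton_iff_unique_mem.2 ⟨hb, fun x hx => ?_⟩
    have h := vsub_mem_vectorSpan ℝ hx hb
    rw [Submodule.finrank_eq_zero.1 hrank, Submodule.mem_bot, vsub_eq_zero_iff_eq] at h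
    exact h
  subst hB
  have hpb : p ≠ b := fun h => hp (h ▸ subset_affineSpan ℝ {p} rfl)
  refine ⟨1, ⟨![p, b], affineIndependent_of_ne ℝ hpb⟩, ?_⟩
  simp [Matrix.range_cons, segment_symm]

/-! ### Conclusion -/

theorem caratheodoryNumber_eq {n : ℕ} {K : Set (EuclideanSpace ℝ (Fin n))} {m : ℕ}
    (hm : HasCaratheodoryProperty K m) (hmin : ∀ k, HasCaratheodoryProperty K k → m ≤ k) :
    caratheodoryNumber K = m :=
  le_antisymm (iInf₂_le m hm) (le_iInf₂ fun k hk => Nat.cast_le.2 (hmin k hk))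

theorem mainTheorem5 (n : ℕ) (K : ConvexBody (EuclideanSpace ℝ (Fin n)))
    (hK : (interior (K : Set (EuclideanSpace ℝ (Fin n)))).Nonempty)
    (P B : Set (EuclideanSpace ℝ (Fin n)))
    (hP : IsPyramidWithBase P B) (hPs : ¬ IsSimplex P)
    (hN : normals (K : Set (EuclideanSpace ℝ (Fin n))) = normals P) :
    caratheodoryNumber (K : Set (EuclideanSpace ℝ (Fin n))) = (relativeFacets B).encard ∧
      caratheodoryNumber (K : Set (EuclideanSpace ℝ (Fin n))) + 1 =
        (normals (K : Set (EuclideanSpace ℝ (Fin n)))).encard := by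
  obtain ⟨hB, hne, hrank, p, hp, rfl⟩ := hP
  have hn : 1 < n := by
    by_contra hn
    exact hPs (isSimplex_convexHull_insert_of_finrank_eq_zero hne (by omega) hp)
  obtain ⟨u₀, c, hu₀, huB, hup⟩ := exists_base_normal hne hrank hp
  have hface := supportFace_base_normal hB.convex hne huB hup
  have himage := image_supportFace_inter_eq_relativeFacets hn hB hne hrank hp hu₀ huB hup
  have hinj := injOn_supportFace_inter hB.convex hne hu₀ hface
  set P := convexHull ℝ (insert p B) with hP
  have hPp : IsPolytope P := isPolytope_convexHull_insert hB p
  have hint : (interior P).Nonempty := interior_convexHull_insert_nonempty hne hrank hp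
  have hpP : p ∈ P := subset_convexHull ℝ _ (Set.mem_insert p B)
  have hfin : (normals P).Finite := hPp.finite_normals
  have hu₀n : u₀ ∈ normals P := mem_normals_of_finrank_supportFace hPp.convex hint hu₀
    (hface.symm ▸ hne) (by rw [hface]; exact hrank)
  have hcard : n + 2 ≤ (normals P).ncard := by
    by_contra h
    exact hPs (hPp.isSimplex_of_ncard_normals_le hint (by omega) (by omega))
  have hScard := Set.ncard_sdiff_singleton_of_mem hu₀n
  obtain ⟨h, q, hKh, hq⟩ := exists_facet_representation K.isCompact.isClosed K.convex hK
  rw [hN] at hKh hq ⊢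
  have hupper : HasCaratheodoryProperty (K : Set (EuclideanSpace ℝ (Fin n)))
      (normals P \ {u₀}).ncard := by
    have h0 := zero_mem_convexHull_of_isBounded K.isCompact.isBounded (hK.mono interior_subset)
      hfin ⟨u₀, hu₀n⟩ hKh
    obtain ⟨w, hw, hw0⟩ := exists_mem_convexHull_diff_singleton h0 hcard
    rw [hScard]
    exact hasCaratheodoryProperty_of_zero_mem_convexHull K.isCompact hfin hKh hw hw0
  have hlower : ∀ k, HasCaratheodoryProperty (K : Set (EuclideanSpace ℝ (Fin n))) k →
      (normals P \ {u₀}).ncard ≤ k := fun k hk => by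
    have hreg : ∀ u ∈ normals P, ∃ y, IsOuterNormalAt P y u ∧ ∀ v, IsOuterNormalAt P y v → v = u :=
      fun u hu => hu
    choose! y hy hyu using hreg
    have hapex : ∀ u ∈ normals P \ {u₀}, p ∈ supportFace P u := fun u hu =>
      apex_mem_supportFace_of_ne hB.convex hne hu₀ hface hu.1 hu.2
    -- The vector from the apex to a regular point of a lateral facet is orthogonal to that facet's
    -- normal and strictly negative on the other lateral normals, since a regular point lies on no
    -- other facet.
    refine ncard_le_of_hasCaratheodoryProperty hfin Set.sdiff_subset hK
      (fun u hu => (hy u hu).1) hKh (fun u hu => (hq u hu).2) (a := fun u => y u - p)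
      (fun u hu => ⟨?_, fun v hv hvu => ?_⟩) (fun v hv => ?_) hk
    · rw [inner_sub_right, inner_eq_of_mem_supportFace (hy u hu.1).2 (hapex u hu), sub_self]
    · rw [inner_sub_right, sub_neg]
      refine lt_of_le_of_ne ((hapex v hv).2 _ (hy u hu.1).2.1) fun heq => hvu ?_
      exact hyu u hu.1 v ⟨(hy v hv.1).1,
        mem_supportFace_of_inner_eq (hy u hu.1).2.1 (hapex v hv) heq⟩
    · obtain ⟨u, hu⟩ : (normals P \ {u₀}).Nonempty :=
        (Set.ncard_pos (hfin.subset Set.sdiff_subset)).1 (by omega)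
      -- The only normal left is that of the base, and the apex minimizes it over the pyramid.
      have hvu : v = u₀ := by
        by_contra hvu
        exact hv.2 ⟨hv.1, hvu⟩
      refine ⟨u, hu, ?_⟩
      rw [inner_sub_right, sub_nonneg, hvu]
      obtain ⟨b, hb, s, t, hs, ht, hst, heq⟩ := mem_convexHull_insert hB.convex hne (hy u hu.1).2.1
      rw [← heq, inner_add_right, real_inner_smul_right, real_inner_smul_right, huB b hb]
      have hs' : s = 1 - t := by linarith
      subst hs'
      nlinarith
  have hnum := caratheodoryNumber_eq hupper hlower
  have hcast : ((normals P \ {u₀}).ncard : ℕ∞) = (normals P \ {u₀}).encard :=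
    (hfin.subset Set.sdiff_subset).cast_ncard_eq
  rw [hnum, hcast]
  refine ⟨?_, Set.encard_sdiff_singleton_add_one hu₀n⟩
  rw [← himage, hinj.encard_image]
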